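/- **Conventions.** Let $\mathrm{L}$ be a (set-sized) relational first order signature: relation symbols of finite arity and constant symbols, no function symbols. $\mathrm{L}_{\infty\omega}$-formulae are built from atomic formulae (including equalities) by $\neg$, conjunctions $\bigwedge\Phi$ and disjunctions $\bigvee\Phi$ of arbitrary sets $\Phi$ of formulae with free variables in a common finite set, and quantification $\forall v,\exists v$ over finitely many variables; formulae are identified up to renaming of bound variables. A theory is a set of sentences. For a complete Boolean algebra $\mathsf{B}$ (with $0\neq 1$), a $\mathsf{B}$-valued model $\mathcal{M}$ is a non-empty set $M$ with elements $c^{\mathcal M}\in M$ for the constants and values $[\![\tau=\sigma]\!],[\![R(\tau_1,\dots,\tau_k)]\!]\in\mathsf{B}$ such that $[\![\tau=\tau]\!]=1$, $[\![\tau=\sigma]\!]=[\![\sigma=\tau]\!]$, $[\![\tau=\sigma]\!]\wedge[\![\sigma=\pi]\!]\le[\![\tau=\pi]\!]$ and $\bigwedge_i[\![\tau_i=\sigma_i]\!]\wedge[\![R(\vec\tau)]\!]\le[\![R(\vec\sigma)]\!]$. Values of formulae are computed by interpreting $\neg,\bigwedge,\bigvee$ by the operations of $\mathsf{B}$, and $\forall,\exists$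 by infima and suprema over $M$. $\mathcal{M}\models\Gamma$ means that each sentence of $\Gamma$ has value $1$; $\Gamma$ is Boolean satisfiable if it has a $\mathsf{B}$-valued model for some such $\mathsf{B}$. $\mathcal{M}$ is mixing if for every set $A\subseteq\mathsf{B}$ of pairwise incompatible elements and every family $(\tau_a)_{a\in A}$ in $M$ there is $\tau\in M$ with $a\le[\![\tau=\tau_a]\!]$ for all $a\in A$. A fragment is a set of $\mathrm{L}_{\infty\omega}$-formulae which contains all equalities $s=t$ between terms (variables and constants) and is closed under $\neg$, binary $\wedge$ and $\vee$, $\forall v$, $\exists v$, subformulae, substitution of variables and constants for free variables, and the operation of moving a negation inside ($\phi\neg$ is $\neg\phi$ for $\phi$ atomic, $\psi$ for $\phi=\neg\psi$, $\bigvee\{\neg\psi:\psi\in\Psi\}$ for $\phi=\bigwedge\Psi$, $\bigwedge\{\neg\psi:\psi\in\Psi\}$ for $\phi=\bigvee\Psi$, $\exists v\,\neg\psi$ for $\phi=\forall v\,\psi$, and $\forall v\,\neg\psi$ for $\phi=\exists v\,\psi$). **Theorem (Boolean Omitting Types Theorem).** Let $T$ be a set-sized Boolean satisfiable $\mathrm{L}_{\infty\omega}$-theory.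 Let $\mathcal{F}$ be a set-sized family such that each $\Phi\in\mathcal{F}$ is a set of $\mathrm{L}_{\infty\omega}$-formulae with free variables among $v_0,\dots,v_{n_\Phi-1}$, $n_\Phi<\omega$. Let $\mathrm{L}_{T,\mathcal{F}}$ be the smallest fragment of $\mathrm{L}_{\infty\omega}$ that contains $T$ and every $\Phi\in\mathcal{F}$. Suppose that no $\Phi\in\mathcal{F}$ is Boolean isolated in $\mathrm{L}_{T,\mathcal{F}}$, i.e. for all $\Phi\in\mathcal F$, all $n_\theta<\omega$ and all $\mathrm{L}_{T,\mathcal{F}}$-formulae $\theta$ with free variables among $v_0,\dots,v_{n_\theta-1}$, $$T\cup\{\exists v_0\dots v_{n_\theta-1}\,\theta\}$$ is Boolean satisfiable if and only if, for some $\phi\in\Phi$, so is $$T\cup\{\exists v_0\dots v_{\max\{n_\theta,n_\Phi\}-1}\,[\theta\wedge\phi]\}.$$ Then there exist a complete Boolean algebra $\mathsf{B}$ (with $0\neq1$) and a $\mathsf{B}$-valued model $\mathcal{M}$ with the mixing property such that $$\mathcal{M}\models T\cup\Big\{\bigwedge_{\Phi\in\mathcal{F}}\forall v_0\dots v_{n_\Phi-1}\,\bigvee\Phi\Big\}.$$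 -/

import Mathlib

universe u

namespace BooleanLogic

/-- A relational first order signature: relation symbols of finite arity and constant symbols,
no function symbols. -/
structure Signature where
  Rel : Type u
  arity : Rel → ℕ
  Const : Type u

/-- Terms in the variables `v_0, …, v_{n-1}`: variables and constant symbols. -/
inductive Term (L : Signature.{u}) (n : ℕ) : Type u
  | var (i : Fin n) : Term L n
  | const (c : L.Const) : Term L n

/-- Formulae of the infinitary logic `L_{∞ω}` with free variables among `v_0, …, v_{n-1}`.
Bound variables are well-scoped: in `all φ` and `ex φ` the quantified variable is the last
variable `v_n` of `φ`. Conjunctions and disjunctions are over arbitrary (possibly empty) sets,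
given as families indexed by a type of the universe `u`, which plays the role of the universe
of sets. -/
inductive Formula (L : Signature.{u}) : ℕ → Type (u + 1)
  | eq {n : ℕ} (s t : Term L n) : Formula L n
  | rel {n : ℕ} (R : L.Rel) (ts : Fin (L.arity R) → Term L n) : Formula L n
  | neg {n : ℕ} (φ : Formula L n) : Formula L n
  | conj {n : ℕ} (ι : Type u) (φ : ι → Formula L n) : Formula L n
  | disj {n : ℕ} (ι : Type u) (φ : ι → Formula L n) : Formula L n
  | all {n : ℕ} (φ : Formula L (n + 1)) : Formula L n
  | ex {n : ℕ} (φ : Formula L (n + 1)) : Formula L n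

abbrev Sentence (L : Signature.{u}) : Type (u + 1) := Formula L 0

namespace Term

variable {L : Signature.{u}}

/-- Substitution of terms for the variables. -/
def subst {n m : ℕ} (σ : Fin n → Term L m) : Term L n → Term L m
  | var i => σ i
  | const c => const c

/-- A term in `v_0, …, v_{n-1}` as a term in `v_0, …, v_n`. -/
def weaken {n : ℕ} (t : Term L n) : Term L (n + 1) :=
  t.subst fun i => var i.castSucc

/-- The substitution `σ` extended by keeping one additional last variable fixed, used under a
quantifier. -/
def liftSubst {n m : ℕ} (σ : Fin n → Term L m) : Fin (n + 1) → Term L (m + 1) :=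
  Fin.snoc (α := fun _ => Term L (m + 1)) (fun i => (σ i).weaken) (var (Fin.last m))

end Term

namespace Formula

variable {L : Signature.{u}}

/-- Simultaneous (capture-free) substitution of terms for the free variables. -/
def subst : {n m : ℕ} → Formula L n → (Fin n → Term L m) → Formula L m
  | _, _, eq s t, σ => eq (s.subst σ) (t.subst σ)
  | _, _, rel R ts, σ => rel R fun i => (ts i).subst σ
  | _, _, neg φ, σ => neg (φ.subst σ)
  | _, _, conj ι φ, σ => conj ι fun i => (φ i).subst σ
  | _, _, disj ι φ, σ => disj ι fun i => (φ i).subst σ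
  | _, _, all φ, σ => all (φ.subst (Term.liftSubst σ))
  | _, _, ex φ, σ => ex (φ.subst (Term.liftSubst σ))

/-- A formula in `v_0, …, v_{n-1}` seen as a formula in `v_0, …, v_{m-1}`, for `n ≤ m`. -/
def castLE {n m : ℕ} (h : n ≤ m) (φ : Formula L n) : Formula L m :=
  φ.subst fun i => Term.var (Fin.castLE h i)

/-- Binary conjunction. -/
def and {n : ℕ} (φ ψ : Formula L n) : Formula L n :=
  conj (ULift.{u} Bool) fun b => if b.down then φ else ψ

/-- Binary disjunction. -/
def or {n : ℕ} (φ ψ : Formula L n) : Formula L n :=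
  disj (ULift.{u} Bool) fun b => if b.down then φ else ψ

/-- Moving a negation inside: a formula equivalent to `¬ φ`. -/
def negInside : {n : ℕ} → Formula L n → Formula L n
  | _, eq s t => neg (eq s t)
  | _, rel R ts => neg (rel R ts)
  | _, neg φ => φ
  | _, conj ι φ => disj ι fun i => neg (φ i)
  | _, disj ι φ => conj ι fun i => neg (φ i)
  | _, all φ => ex (neg φ)
  | _, ex φ => all (neg φ)

/-- The sentence `∃ v_0 … v_{n-1} φ`. -/
def exists_closure : {n : ℕ} → Formula L n → Sentence L
  | 0, φ => φ
  | _ + 1, φ => exists_closure (ex φ)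

/-- The sentence `∀ v_0 … v_{n-1} φ`. -/
def forall_closure : {n : ℕ} → Formula L n → Sentence L
  | 0, φ => φ
  | _ + 1, φ => forall_closure (all φ)

end Formula

/-- A `B`-valued model for `L`, where `B` is a complete Boolean algebra. -/
structure BVModel (L : Signature.{u}) (B : Type u) [CompleteBooleanAlgebra B] where
  carrier : Type u
  nonempty : Nonempty carrier
  eqVal : carrier → carrier → B
  relVal : (R : L.Rel) → (Fin (L.arity R) → carrier) → B
  constVal : L.Const → carrier
  eqVal_refl : ∀ x, eqVal x x = ⊤
  eqVal_symm : ∀ x y, eqVal x y = eqVal y x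
  eqVal_trans : ∀ x y z, eqVal x y ⊓ eqVal y z ≤ eqVal x z
  relVal_congr : ∀ (R : L.Rel) (x y : Fin (L.arity R) → carrier),
    (⨅ i, eqVal (x i) (y i)) ⊓ relVal R x ≤ relVal R y

namespace BVModel

variable {L : Signature.{u}} {B : Type u} [CompleteBooleanAlgebra B]

/-- The value of a term under an assignment. -/
def termVal (M : BVModel L B) {n : ℕ} (v : Fin n → M.carrier) : Term L n → M.carrier
  | Term.var i => v i
  | Term.const c => M.constVal c

/-- The Boolean value of a formula under an assignment. -/
def val (M : BVModel L B) : {n : ℕ} → Formula L n → (Fin n → M.carrier) → B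
  | _, Formula.eq s t, v => M.eqVal (M.termVal v s) (M.termVal v t)
  | _, Formula.rel R ts, v => M.relVal R fun i => M.termVal v (ts i)
  | _, Formula.neg φ, v => (M.val φ v)ᶜ
  | _, Formula.conj _ φ, v => ⨅ i, M.val (φ i) v
  | _, Formula.disj _ φ, v => ⨆ i, M.val (φ i) v
  | n, Formula.all φ, v =>
      ⨅ a : M.carrier, M.val φ (Fin.snoc (α := fun _ : Fin (n + 1) => M.carrier) v a)
  | n, Formula.ex φ, v =>
      ⨆ a : M.carrier, M.val φ (Fin.snoc (α := fun _ : Fin (n + 1) => M.carrier) v a)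

/-- `M ⊨ Γ`: every sentence of `Γ` has value `1`. -/
def Models (M : BVModel L B) (Γ : Set (Sentence L)) : Prop :=
  ∀ φ ∈ Γ, M.val φ Fin.elim0 = ⊤

/-- The mixing property. An antichain is a set of pairwise incompatible elements. -/
def Mixing (M : BVModel L B) : Prop :=
  ∀ (A : Set B), A.Pairwise Disjoint → ∀ τ : A → M.carrier,
    ∃ x : M.carrier, ∀ a : A, (a : B) ≤ M.eqVal x (τ a)

end BVModel

/-- A set of sentences is Boolean satisfiable if it has a `B`-valued model for some complete
Boolean algebra `B` (with `0 ≠ 1`). -/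
def BooleanSatisfiable {L : Signature.{u}} (Γ : Set (Sentence L)) : Prop :=
  ∃ (B : Type u) (_ : CompleteBooleanAlgebra B) (_ : Nontrivial B) (M : BVModel L B), M.Models Γ

/-- A fragment of `L_{∞ω}`; `A n` is the set of its formulae in the variables
`v_0, …, v_{n-1}`. -/
structure IsFragment {L : Signature.{u}} (A : (n : ℕ) → Set (Formula L n)) : Prop where
  /-- equalities between terms are in the fragment -/
  eq_mem : ∀ {n} (s t : Term L n), Formula.eq s t ∈ A n
  /-- closure under the finitary connectives and quantifiers -/
  neg_mem : ∀ {n} {φ : Formula L n}, φ ∈ A n → φ.neg ∈ A n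
  and_mem : ∀ {n} {φ ψ : Formula L n}, φ ∈ A n → ψ ∈ A n → φ.and ψ ∈ A n
  or_mem : ∀ {n} {φ ψ : Formula L n}, φ ∈ A n → ψ ∈ A n → φ.or ψ ∈ A n
  all_mem : ∀ {n} {φ : Formula L (n + 1)}, φ ∈ A (n + 1) → φ.all ∈ A n
  ex_mem : ∀ {n} {φ : Formula L (n + 1)}, φ ∈ A (n + 1) → φ.ex ∈ A n
  /-- closure under subformulae -/
  of_neg : ∀ {n} {φ : Formula L n}, φ.neg ∈ A n → φ ∈ A n
  of_conj : ∀ {n} {ι : Type u} {φ : ι → Formula L n}, Formula.conj ι φ ∈ A n → ∀ i, φ i ∈ A n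
  of_disj : ∀ {n} {ι : Type u} {φ : ι → Formula L n}, Formula.disj ι φ ∈ A n → ∀ i, φ i ∈ A n
  of_all : ∀ {n} {φ : Formula L (n + 1)}, φ.all ∈ A n → φ ∈ A (n + 1)
  of_ex : ∀ {n} {φ : Formula L (n + 1)}, φ.ex ∈ A n → φ ∈ A (n + 1)
  /-- closure under moving a negation inside -/
  negInside_mem : ∀ {n} {φ : Formula L n}, φ ∈ A n → φ.negInside ∈ A n
  /-- closure under substitution of variables and constants for free variables -/
  subst_mem : ∀ {n m} {φ : Formula L n} (σ : Fin n → Term L m), φ ∈ A n → φ.subst σ ∈ A m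

/-- A set `Φ` of `L_{∞ω}`-formulae with free variables among `v_0, …, v_{n-1}`. -/
structure FormulaSet (L : Signature.{u}) where
  n : ℕ
  formulas : Set (Formula L n)
  small : Small.{u} formulas

/-- The disjunction `⋁ Φ`. -/
noncomputable def FormulaSet.bigOr {L : Signature.{u}} (Φ : FormulaSet L) : Formula L Φ.n :=
  haveI := Φ.small
  Formula.disj (Shrink.{u} Φ.formulas) fun i => ((equivShrink Φ.formulas).symm i).1

/-- The sentence `⋀_{Φ ∈ F} ∀ v_0 … v_{n_Φ - 1} ⋁ Φ`. -/
noncomputable def omittingSentence {L : Signature.{u}} (F : Set (FormulaSet L)) [Small.{u} F] :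
    Sentence L :=
  Formula.conj (Shrink.{u} F) fun i => ((equivShrink F).symm i).1.bigOr.forall_closure

/-- `T ⊆ A` and `Φ ⊆ A` for all `Φ ∈ F`. -/
def Contains {L : Signature.{u}} (A : (n : ℕ) → Set (Formula L n)) (T : Set (Sentence L))
    (F : Set (FormulaSet L)) : Prop :=
  T ⊆ A 0 ∧ ∀ Φ ∈ F, Φ.formulas ⊆ A Φ.n

/-- The smallest fragment `L_{T,F}` that contains `T` and every `Φ ∈ F`. -/
def generatedFragment {L : Signature.{u}} (T : Set (Sentence L)) (F : Set (FormulaSet L)) (n : ℕ) :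
    Set (Formula L n) :=
  {φ | ∀ A : (n : ℕ) → Set (Formula L n), IsFragment A → Contains A T F → φ ∈ A n}

theorem isFragment_generatedFragment {L : Signature.{u}} (T : Set (Sentence L))
    (F : Set (FormulaSet L)) : IsFragment (generatedFragment T F) where
  eq_mem s t _ hA _ := hA.eq_mem s t
  neg_mem h A hA hc := hA.neg_mem (h A hA hc)
  and_mem h h' A hA hc := hA.and_mem (h A hA hc) (h' A hA hc)
  or_mem h h' A hA hc := hA.or_mem (h A hA hc) (h' A hA hc)
  all_mem h A hA hc := hA.all_mem (h A hA hc)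
  ex_mem h A hA hc := hA.ex_mem (h A hA hc)
  of_neg h A hA hc := hA.of_neg (h A hA hc)
  of_conj h i A hA hc := hA.of_conj (h A hA hc) i
  of_disj h i A hA hc := hA.of_disj (h A hA hc) i
  of_all h A hA hc := hA.of_all (h A hA hc)
  of_ex h A hA hc := hA.of_ex (h A hA hc)
  negInside_mem h A hA hc := hA.negInside_mem (h A hA hc)
  subst_mem σ h A hA hc := hA.subst_mem σ (h A hA hc)

theorem contains_generatedFragment {L : Signature.{u}} (T : Set (Sentence L))
    (F : Set (FormulaSet L)) : Contains (generatedFragment T F) T F :=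
  ⟨fun _ h _ _ hc => hc.1 h, fun Φ hΦ _ h _ _ hc => hc.2 Φ hΦ h⟩

/-- `Φ` is Boolean isolated over `T` in the fragment `A`: it is not the case that for all `θ` in
`A` with free variables among `v_0, …, v_{m-1}`, the theory `T + ∃ v̄ θ` is Boolean satisfiable if
and only if so is `T + ∃ v̄ (θ ∧ φ)` for some `φ ∈ Φ`. -/
def BooleanIsolated {L : Signature.{u}} (T : Set (Sentence L))
    (A : (n : ℕ) → Set (Formula L n)) (Φ : FormulaSet L) : Prop :=
  ¬ ∀ (m : ℕ), ∀ θ ∈ A m,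
    (BooleanSatisfiable (T ∪ {θ.exists_closure}) ↔
      ∃ φ ∈ Φ.formulas, BooleanSatisfiable (T ∪
        {((θ.castLE (le_max_left m Φ.n)).and (φ.castLE (le_max_right m Φ.n))).exists_closure}))

end BooleanLogic

open BooleanLogic

/-! The model is built by forcing. Add countably many new constants, written as the variables `v_0,
v_1, …`. Conditions are the formulae of the fragment that take a non-zero value in some Boolean
valued model of `T`, ordered by entailment in all such models. The algebra is that of the regular
down-sets of conditions, and the points of `genericModel` are the old and new constants.

The set of conditions entailing `φ(x)` turns negation into pseudo-complement (`forcingSet_neg`),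
conjunction into intersection and `∀` into intersection over all names, a fresh constant serving as
a generic element (`forcingSet_all`). Hence it is the value of `φ(x)` whenever `φ` is in the
fragment (`coe_val_genericModel`), and `T` holds. Countability plays no role, since no filter has to
meet the dense sets: a dense family of conditions already has supremum `1`. Non-isolation of `Φ`
says that the conditions entailing some `φ(x)` with `φ ∈ Φ` are dense, so `⋁ Φ` has value `1` at
every tuple of names.

Finally, adjoining all mixtures of elements gives the mixing property and preserves all values
(`val_mixing`). -/

namespace BooleanLogic

variable {L : Signature.{u}} {B : Type u} [CompleteBooleanAlgebra B]

/-! ### Substitution, congruence and closures in Boolean valued models -/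

namespace BVModel

theorem termVal_subst (M : BVModel L B) {n m : ℕ} (σ : Fin n → Term L m) (t : Term L n)
    (v : Fin m → M.carrier) :
    M.termVal v (t.subst σ) = M.termVal (fun i => M.termVal v (σ i)) t := by
  cases t <;> rfl

theorem termVal_weaken (M : BVModel L B) {n : ℕ} (t : Term L n) (v : Fin n → M.carrier)
    (a : M.carrier) :
    M.termVal (Fin.snoc (α := fun _ : Fin (n + 1) => M.carrier) v a) t.weaken = M.termVal v t := by
  rw [Term.weaken, termVal_subst]
  congr 1
  funext i
  simp [termVal]

theorem termVal_liftSubst (M : BVModel L B) {n m : ℕ} (σ : Fin n → Term L m)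
    (v : Fin m → M.carrier) (a : M.carrier) :
    (fun i => M.termVal (Fin.snoc (α := fun _ : Fin (m + 1) => M.carrier) v a)
      (Term.liftSubst σ i)) =
    Fin.snoc (α := fun _ : Fin (n + 1) => M.carrier) (fun i => M.termVal v (σ i)) a := by
  funext i
  refine Fin.lastCases ?_ (fun j => ?_) i
  · simp [Term.liftSubst, termVal]
  · simp [Term.liftSubst, termVal_weaken]

theorem val_subst (M : BVModel L B) {n m : ℕ} (φ : Formula L n) (σ : Fin n → Term L m)
    (v : Fin m → M.carrier) :
    M.val (φ.subst σ) v = M.val φ (fun i => M.termVal v (σ i)) := by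
  induction φ generalizing m with
  | eq s t => simp only [Formula.subst, val, termVal_subst]
  | rel R ts => simp only [Formula.subst, val, termVal_subst]
  | neg φ ih => simp only [Formula.subst, val, ih]
  | conj ι φ ih => simp only [Formula.subst, val, ih]
  | disj ι φ ih => simp only [Formula.subst, val, ih]
  | all φ ih => simp only [Formula.subst, val, ih, termVal_liftSubst]
  | ex φ ih => simp only [Formula.subst, val, ih, termVal_liftSubst]

theorem val_castLE (M : BVModel L B) {n m : ℕ} (h : n ≤ m) (φ : Formula L n)
    (v : Fin m → M.carrier) :
    M.val (φ.castLE h) v = M.val φ (fun i => v (Fin.castLE h i)) :=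
  M.val_subst φ _ v

theorem val_and (M : BVModel L B) {n : ℕ} (φ ψ : Formula L n) (v : Fin n → M.carrier) :
    M.val (φ.and ψ) v = M.val φ v ⊓ M.val ψ v := by
  simp only [Formula.and, val]
  apply le_antisymm
  · exact le_inf ((iInf_le _ ⟨true⟩).trans (by simp)) ((iInf_le _ ⟨false⟩).trans (by simp))
  · refine le_iInf ?_
    rintro ⟨_ | _⟩ <;> simp

theorem iInf_eqVal_le_termVal (M : BVModel L B) {n : ℕ} (t : Term L n) (v w : Fin n → M.carrier) :
    (⨅ i, M.eqVal (v i) (w i)) ≤ M.eqVal (M.termVal v t) (M.termVal w t) := by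
  cases t with
  | var i => exact iInf_le _ i
  | const c => simp [termVal, M.eqVal_refl]

theorem iInf_eqVal_snoc (M : BVModel L B) {n : ℕ} (v w : Fin n → M.carrier) (a b : M.carrier) :
    (⨅ i, M.eqVal (Fin.snoc (α := fun _ : Fin (n + 1) => M.carrier) v a i)
      (Fin.snoc (α := fun _ : Fin (n + 1) => M.carrier) w b i)) =
    (⨅ i, M.eqVal (v i) (w i)) ⊓ M.eqVal a b := by
  apply le_antisymm
  · refine le_inf (le_iInf fun i => (iInf_le _ i.castSucc).trans (by simp))
      ((iInf_le _ (Fin.last n)).trans (by simp))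
  · refine le_iInf fun i => ?_
    refine Fin.lastCases ?_ (fun j => ?_) i
    · simp
    · simp only [Fin.snoc_castSucc]
      exact inf_le_left.trans (iInf_le _ j)

/-- The Boolean Leibniz law. The induction needs all pairs of assignments at once, because the
negation case uses the hypothesis with `v` and `w` exchanged. -/
theorem val_congr (M : BVModel L B) {n : ℕ} (φ : Formula L n) (v w : Fin n → M.carrier) :
    (⨅ i, M.eqVal (v i) (w i)) ⊓ M.val φ v ≤ M.val φ w := by
  induction φ with
  | eq s t =>
    have hs := M.iInf_eqVal_le_termVal s v w
    have ht := M.iInf_eqVal_le_termVal t v w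
    rw [M.eqVal_symm] at hs
    simp only [val]
    refine le_trans ?_ (M.eqVal_trans _ (M.termVal v s) _)
    refine le_inf (inf_le_left.trans hs) (le_trans ?_ (M.eqVal_trans _ (M.termVal v t) _))
    exact le_inf inf_le_right (inf_le_left.trans ht)
  | rel R ts =>
    refine le_trans ?_ (M.relVal_congr R (fun i => M.termVal v (ts i)) _)
    exact inf_le_inf_right _ (le_iInf fun i => M.iInf_eqVal_le_termVal (ts i) v w)
  | neg φ ih =>
    have h := ih w v
    simp only [M.eqVal_symm (w _)] at h
    simp only [val]
    rw [le_compl_iff_disjoint_right, disjoint_iff_inf_le]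
    calc _ = ((⨅ i, M.eqVal (v i) (w i)) ⊓ M.val φ w) ⊓ (M.val φ v)ᶜ := by ac_rfl
      _ ≤ M.val φ v ⊓ (M.val φ v)ᶜ := inf_le_inf_right _ h
      _ ≤ ⊥ := by simp
  | conj ι φ ih =>
    exact le_iInf fun i => (inf_le_inf_left _ (iInf_le _ i)).trans (ih i v w)
  | disj ι φ ih =>
    simp only [val, inf_iSup_eq]
    exact iSup_le fun i => (ih i v w).trans (le_iSup (fun i => M.val (φ i) w) i)
  | all φ ih =>
    refine le_iInf fun a => (inf_le_inf_left _ (iInf_le _ a)).trans ?_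
    refine le_trans ?_ (ih (Fin.snoc v a) (Fin.snoc w a))
    rw [iInf_eqVal_snoc, M.eqVal_refl, inf_top_eq]
  | ex φ ih =>
    simp only [val, inf_iSup_eq]
    refine iSup_le fun a => le_trans ?_
      (le_iSup (fun a => M.val φ (Fin.snoc (α := fun _ => M.carrier) w a)) a)
    refine le_trans ?_ (ih (Fin.snoc v a) (Fin.snoc w a))
    rw [iInf_eqVal_snoc, M.eqVal_refl, inf_top_eq]

theorem val_le_val_exists_closure (M : BVModel L B) {n : ℕ} (φ : Formula L n)
    (v : Fin n → M.carrier) : M.val φ v ≤ M.val φ.exists_closure Fin.elim0 := by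
  induction n with
  | zero => rw [Subsingleton.elim v Fin.elim0]; rfl
  | succ n ih =>
    refine le_trans ?_ (ih (Formula.ex φ) (Fin.init v))
    refine le_trans ?_ (le_iSup (fun a => M.val φ
      (Fin.snoc (α := fun _ => M.carrier) (Fin.init v) a)) (v (Fin.last n)))
    rw [Fin.snoc_init_self]

theorem exists_val_ne_bot (M : BVModel L B) {n : ℕ} (φ : Formula L n)
    (h : M.val φ.exists_closure Fin.elim0 ≠ ⊥) : ∃ v, M.val φ v ≠ ⊥ := by
  induction n with
  | zero => exact ⟨_, h⟩
  | succ n ih =>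
    obtain ⟨v, hv⟩ := ih (Formula.ex φ) h
    by_contra hc
    push Not at hc
    exact hv (by simp [val, hc])

theorem val_forall_closure_eq_top (M : BVModel L B) {n : ℕ} (φ : Formula L n)
    (h : ∀ v, M.val φ v = ⊤) : M.val φ.forall_closure Fin.elim0 = ⊤ := by
  induction n with
  | zero => exact h _
  | succ n ih => exact ih (Formula.all φ) fun v => by simp [val, h]

end BVModel

/-! ### Restriction of a model below an element, and consistency -/

/-- The Boolean algebra of the elements below `b`, with relative complements. -/
noncomputable instance iicCompleteBooleanAlgebra (b : B) : CompleteBooleanAlgebra (Set.Iic b) where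
  __ := (inferInstance : CompleteLattice (Set.Iic b))
  le_sup_inf x y z := by
    change ((x : B) ⊔ y) ⊓ (x ⊔ z) ≤ (x : B) ⊔ y ⊓ z
    exact le_sup_inf
  compl x := ⟨(x : B)ᶜ ⊓ b, inf_le_right⟩
  inf_compl_le_bot x := by
    change (x : B) ⊓ ((x : B)ᶜ ⊓ b) ≤ ⊥
    simp [← inf_assoc]
  top_le_sup_compl x := by
    change b ≤ (x : B) ⊔ ((x : B)ᶜ ⊓ b)
    simp [sup_inf_left]

theorem coe_compl_iic {b : B} (x : Set.Iic b) : ((xᶜ : Set.Iic b) : B) = (x : B)ᶜ ⊓ b := rfl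

namespace BVModel

/-- The meet with `b` stays outside on the right because the empty infimum of `Set.Iic b` is `b`. -/
theorem coe_iInf_inf {ι : Sort*} (b : B) (f : ι → B) :
    ((⨅ i, (⟨f i ⊓ b, inf_le_right⟩ : Set.Iic b) : Set.Iic b) : B) = (⨅ i, f i) ⊓ b := by
  rw [Set.Iic.coe_iInf]
  apply le_antisymm
  · exact le_inf (le_iInf fun i => inf_le_right.trans ((iInf_le _ i).trans inf_le_left)) inf_le_left
  · exact le_inf inf_le_right (le_iInf fun i => inf_le_inf_right _ (iInf_le _ i))

/-- The restriction of a model to the algebra of the elements below `b`. -/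
noncomputable def restrict (M : BVModel L B) (b : B) : BVModel L (Set.Iic b) where
  carrier := M.carrier
  nonempty := M.nonempty
  eqVal x y := ⟨M.eqVal x y ⊓ b, inf_le_right⟩
  relVal R x := ⟨M.relVal R x ⊓ b, inf_le_right⟩
  constVal := M.constVal
  eqVal_refl x := Subtype.ext (by simp [M.eqVal_refl])
  eqVal_symm x y := by simp only [M.eqVal_symm x y]
  eqVal_trans x y z := by
    change (M.eqVal x y ⊓ b) ⊓ (M.eqVal y z ⊓ b) ≤ M.eqVal x z ⊓ b
    rw [← inf_inf_distrib_right]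
    exact inf_le_inf_right _ (M.eqVal_trans x y z)
  relVal_congr R x y := by
    rw [← Subtype.coe_le_coe]
    change ((⨅ i, _ : Set.Iic b) : B) ⊓ (M.relVal R x ⊓ b) ≤ M.relVal R y ⊓ b
    rw [coe_iInf_inf, ← inf_inf_distrib_right]
    exact inf_le_inf_right _ (M.relVal_congr R x y)

theorem termVal_restrict (M : BVModel L B) (b : B) {n : ℕ} (t : Term L n)
    (v : Fin n → M.carrier) : (M.restrict b).termVal v t = M.termVal v t := by
  cases t <;> rfl

/-- Meeting with `b` is a complete homomorphism onto the relative algebra, so it commutes with every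
clause of the evaluation. -/
theorem val_restrict (M : BVModel L B) (b : B) {n : ℕ} (φ : Formula L n) (v : Fin n → M.carrier) :
    (M.restrict b).val φ v = (⟨M.val φ v ⊓ b, inf_le_right⟩ : Set.Iic b) := by
  induction φ with
  | eq s t => simp only [val, termVal_restrict]; rfl
  | rel R ts => simp only [val, termVal_restrict]; rfl
  | neg φ ih =>
    refine Subtype.ext ?_
    simp only [val, coe_compl_iic, ih]
    simp [compl_inf, inf_sup_right]
  | conj ι φ ih =>
    refine Subtype.ext ?_
    simp only [val, ih, coe_iInf_inf]
  | disj ι φ ih =>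
    refine Subtype.ext ?_
    simp only [val, ih, Set.Iic.coe_iSup, iSup_inf_eq]
  | all φ ih =>
    refine Subtype.ext ?_
    have h : ∀ a, (M.restrict b).val φ (Fin.snoc v a) = _ := fun a => ih (Fin.snoc v a)
    simp only [val]
    exact (congrArg Subtype.val (iInf_congr h)).trans (coe_iInf_inf _ _)
  | ex φ ih =>
    refine Subtype.ext ?_
    have h : ∀ a, (M.restrict b).val φ (Fin.snoc v a) = _ := fun a => ih (Fin.snoc v a)
    simp only [val]
    refine (congrArg Subtype.val (iSup_congr h)).trans ?_
    rw [Set.Iic.coe_iSup, iSup_inf_eq]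
    rfl

end BVModel

/-- Some Boolean valued model of `T` gives a non-zero value to an instance of `φ`. -/
def Consistent (T : Set (Sentence L)) {n : ℕ} (φ : Formula L n) : Prop :=
  ∃ (B : Type u) (_ : CompleteBooleanAlgebra B) (M : BVModel L B),
    M.Models T ∧ ∃ v, M.val φ v ≠ ⊥

/-- Restricting to the elements below a non-zero value of `φ` makes that value `1` and keeps `T`
valid. Conversely, a supremum equal to `1 ≠ 0` has a non-zero term. -/
theorem consistent_iff_booleanSatisfiable (T : Set (Sentence L)) {n : ℕ} (φ : Formula L n) :
    Consistent T φ ↔ BooleanSatisfiable (T ∪ {φ.exists_closure}) := by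
  constructor
  · rintro ⟨B, _, M, hM, v, hv⟩
    refine ⟨Set.Iic (M.val φ v), inferInstance, ⟨⊥, ⊤, fun h => hv ?_⟩, M.restrict _, ?_⟩
    · exact (congrArg Subtype.val h).symm
    · rintro ψ (hψ | rfl)
      · have h := M.val_restrict (M.val φ v) ψ Fin.elim0
        rw [hM ψ hψ] at h
        refine (congrArg _ (Subsingleton.elim _ _)).trans (h.trans (Subtype.ext ?_))
        simp
      · refine (congrArg _ (Subsingleton.elim _ _)).trans
          ((M.val_restrict (M.val φ v) _ Fin.elim0).trans (Subtype.ext ?_))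
        simp [M.val_le_val_exists_closure φ v]
  · rintro ⟨B, _, _, M, hM⟩
    refine ⟨B, inferInstance, M, fun ψ hψ => hM ψ (Or.inl hψ), M.exists_val_ne_bot φ ?_⟩
    rw [hM _ (Or.inr rfl)]
    exact top_ne_bot

end BooleanLogic

/-! ### The mixing completion of a model -/

namespace BooleanLogic

variable {L : Signature.{u}} {B : Type u} [CompleteBooleanAlgebra B]

namespace BVModel

/-- A mixture of elements of `M`, given by the values of its equality with the elements of `M`. -/
structure Mixture (M : BVModel L B) where
  val : M.carrier → B
  inf_eqVal_le : ∀ c d, val c ⊓ M.eqVal c d ≤ val d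
  inf_le_eqVal : ∀ c d, val c ⊓ val d ≤ M.eqVal c d
  iSup_val : ⨆ c, val c = ⊤

namespace Mixture

variable {M : BVModel L B}

/-- An element of `M` as a mixture. -/
def of (M : BVModel L B) (c : M.carrier) : Mixture M where
  val := M.eqVal c
  inf_eqVal_le d e := M.eqVal_trans c d e
  inf_le_eqVal d e := by rw [M.eqVal_symm c d]; exact M.eqVal_trans d c e
  iSup_val := top_le_iff.1 ((M.eqVal_refl c).ge.trans (le_iSup (M.eqVal c) c))

/-- The mixture of a family of mixtures along a partition. -/
noncomputable def glue {ι : Type*} (b : ι → B) (hb : Pairwise fun i j => Disjoint (b i) (b j))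
    (hb' : ⨆ i, b i = ⊤) (f : ι → Mixture M) : Mixture M where
  val c := ⨆ i, b i ⊓ (f i).val c
  inf_eqVal_le c d := by
    rw [iSup_inf_eq]
    refine iSup_mono fun i => ?_
    rw [inf_assoc]
    exact inf_le_inf_left _ ((f i).inf_eqVal_le c d)
  inf_le_eqVal c d := by
    rw [iSup_inf_iSup]
    refine iSup_le fun ⟨i, j⟩ => ?_
    rcases eq_or_ne i j with rfl | hij
    · exact (inf_le_inf inf_le_right inf_le_right).trans ((f i).inf_le_eqVal c d)
    · exact (inf_le_inf inf_le_left inf_le_left).trans ((hb hij).le_bot.trans bot_le)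
  iSup_val := by
    rw [iSup_comm, ← hb']
    exact iSup_congr fun i => by rw [← inf_iSup_eq, (f i).iSup_val, inf_top_eq]

/-- The right-hand side is the value in `mixing` of the equality of the glued mixture with `f i`, so
this is the mixing property for partitions. -/
theorem le_glue {ι : Type*} (b : ι → B) (hb : Pairwise fun i j => Disjoint (b i) (b j))
    (hb' : ⨆ i, b i = ⊤) (f : ι → Mixture M) (i : ι) :
    b i ≤ ⨆ c, (glue b hb hb' f).val c ⊓ (f i).val c := by
  calc b i = ⨆ c, b i ⊓ (f i).val c := by rw [← inf_iSup_eq, (f i).iSup_val, inf_top_eq]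
    _ ≤ _ := iSup_mono fun c =>
      le_inf (le_iSup (fun j => b j ⊓ (f j).val c) i) inf_le_right

end Mixture

/-- The model of the mixtures of elements of `M`. -/
noncomputable def mixing (M : BVModel L B) : BVModel L B where
  carrier := Mixture M
  nonempty := M.nonempty.map (Mixture.of M)
  eqVal f g := ⨆ c, f.val c ⊓ g.val c
  relVal R f := ⨆ c : Fin (L.arity R) → M.carrier, (⨅ i, (f i).val (c i)) ⊓ M.relVal R c
  constVal c := Mixture.of M (M.constVal c)
  eqVal_refl f := by simp [f.iSup_val]
  eqVal_symm f g := by simp only [inf_comm]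
  eqVal_trans f g h := by
    rw [iSup_inf_iSup]
    refine iSup_le fun ⟨c, d⟩ => le_trans ?_ (le_iSup _ d)
    refine le_inf (le_trans ?_ (f.inf_eqVal_le c d)) (inf_le_right.trans inf_le_right)
    exact le_inf (inf_le_left.trans inf_le_left)
      ((inf_le_inf inf_le_right inf_le_left).trans (g.inf_le_eqVal c d))
  relVal_congr R f g := by
    rw [inf_iSup_eq]
    refine iSup_le fun c => le_trans ?_ (le_iSup _ c)
    refine le_inf (le_iInf fun i => ?_) (inf_le_right.trans inf_le_right)
    refine (inf_le_inf (iInf_le _ i) (inf_le_left.trans (iInf_le _ i))).trans ?_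
    rw [iSup_inf_eq]
    refine iSup_le fun d => le_trans ?_ ((g i).inf_eqVal_le d (c i))
    exact le_inf (inf_le_left.trans inf_le_right)
      ((inf_le_inf_right _ inf_le_left).trans ((f i).inf_le_eqVal d (c i)))

theorem mixing_mixing (M : BVModel L B) : M.mixing.Mixing := by
  intro A hA τ
  -- The antichain is completed to a partition by the complement of its supremum, on which an
  -- arbitrary element is used.
  let b : Option A → B := fun o => o.elim (⨆ a : A, (a : B))ᶜ fun a => a
  have hc : Disjoint (⨆ a : A, (a : B))ᶜ (⨆ a : A, (a : B)) := disjoint_compl_left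
  have hb : Pairwise fun i j => Disjoint (b i) (b j) := by
    rintro (_ | i) (_ | j) hij
    · exact absurd rfl hij
    · exact hc.mono_right (le_iSup (fun a : A => (a : B)) j)
    · exact hc.symm.mono_left (le_iSup (fun a : A => (a : B)) i)
    · exact hA i.2 j.2 fun h => hij (congrArg some (Subtype.ext h))
  have hb' : ⨆ i, b i = ⊤ := by
    rw [iSup_option]
    exact compl_sup_eq_top
  obtain ⟨c⟩ := M.nonempty
  let f : Option A → Mixture M := fun o => o.elim (Mixture.of M c) τ
  exact ⟨Mixture.glue b hb hb' f, fun a => Mixture.le_glue b hb hb' f (some a)⟩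

/-- The embedding of `M` into the model of its mixtures. -/
def toMixing (M : BVModel L B) (c : M.carrier) : M.mixing.carrier := Mixture.of M c

theorem eqVal_toMixing_left (M : BVModel L B) (c : M.carrier) (f : M.mixing.carrier) :
    M.mixing.eqVal (M.toMixing c) f = Mixture.val f c := by
  apply le_antisymm
  · refine iSup_le fun d => ?_
    change M.eqVal c d ⊓ Mixture.val f d ≤ Mixture.val f c
    rw [inf_comm, M.eqVal_symm]
    exact Mixture.inf_eqVal_le f d c
  · refine le_trans ?_ (le_iSup _ c)
    exact le_inf ((M.eqVal_refl c).ge.trans' le_top) le_rfl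

theorem eqVal_toMixing (M : BVModel L B) (c d : M.carrier) :
    M.mixing.eqVal (M.toMixing c) (M.toMixing d) = M.eqVal c d := by
  rw [eqVal_toMixing_left, M.eqVal_symm]
  rfl

/-- Density of `M` among its mixtures; this is what reduces quantifiers over mixtures to quantifiers
over `M`. -/
theorem iSup_eqVal_toMixing (M : BVModel L B) (f : M.mixing.carrier) :
    ⨆ c, M.mixing.eqVal (M.toMixing c) f = ⊤ := by
  simp only [eqVal_toMixing_left]
  exact Mixture.iSup_val f

theorem relVal_toMixing (M : BVModel L B) (R : L.Rel) (x : Fin (L.arity R) → M.carrier) :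
    M.mixing.relVal R (fun i => M.toMixing (x i)) = M.relVal R x := by
  apply le_antisymm
  · exact iSup_le fun c => M.relVal_congr R c _ |>.trans' (inf_le_inf_right _
      (iInf_mono fun i => (M.eqVal_symm _ _).le))
  · refine le_trans ?_ (le_iSup _ x)
    exact le_inf (le_iInf fun i => (M.eqVal_refl _).ge.trans' le_top) le_rfl

theorem termVal_toMixing (M : BVModel L B) {n : ℕ} (t : Term L n) (v : Fin n → M.carrier) :
    M.mixing.termVal (fun i => M.toMixing (v i)) t = M.toMixing (M.termVal v t) := by
  cases t <;> rfl

theorem inf_val_snoc_le (M : BVModel L B) {n : ℕ} (φ : Formula L (n + 1)) (v : Fin n → M.carrier)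
    (a b : M.carrier) :
    M.eqVal a b ⊓ M.val φ (Fin.snoc (α := fun _ => M.carrier) v a) ≤
      M.val φ (Fin.snoc (α := fun _ => M.carrier) v b) := by
  refine le_trans (inf_le_inf_right _ ?_) (M.val_congr φ _ _)
  rw [iInf_eqVal_snoc]
  exact le_inf (le_iInf fun i => (M.eqVal_refl _).ge.trans' le_top) le_rfl

theorem snoc_toMixing (M : BVModel L B) {n : ℕ} (v : Fin n → M.carrier) (c : M.carrier) :
    Fin.snoc (α := fun _ => M.mixing.carrier) (fun i => M.toMixing (v i)) (M.toMixing c) =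
      fun i => M.toMixing (Fin.snoc (α := fun _ => M.carrier) v c i) := by
  funext i
  refine Fin.lastCases ?_ (fun j => ?_) i
  · simp only [Fin.snoc_last]
  · simp only [Fin.snoc_castSucc]

theorem val_mixing (M : BVModel L B) {n : ℕ} (φ : Formula L n) (v : Fin n → M.carrier) :
    M.mixing.val φ (fun i => M.toMixing (v i)) = M.val φ v := by
  induction φ with
  | eq s t => simp only [val, termVal_toMixing, eqVal_toMixing]
  | rel R ts => simp only [val, termVal_toMixing, relVal_toMixing]
  | neg φ ih => simp only [val, ih]
  | conj ι φ ih => simp only [val, ih]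
  | disj ι φ ih => simp only [val, ih]
  | all φ ih =>
    have h : ∀ c, M.mixing.val φ (Fin.snoc (fun i => M.toMixing (v i)) (M.toMixing c)) =
        M.val φ (Fin.snoc v c) := fun c => by rw [snoc_toMixing]; exact ih _
    simp only [val]
    apply le_antisymm
    · exact le_iInf fun c => (iInf_le _ (M.toMixing c)).trans (h c).le
    · refine le_iInf fun f => ?_
      -- Split `1` into the values of `c = f` for `c` in `M`; on each piece the instance at `c`
      -- yields the one at `f`.
      refine le_trans ?_ (iSup_le fun c => M.mixing.inf_val_snoc_le φ _ (M.toMixing c) f)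
      simp only [h]
      rw [← top_inf_eq (⨅ a, _), ← M.iSup_eqVal_toMixing f, iSup_inf_eq]
      exact iSup_mono fun c => inf_le_inf_left _ (iInf_le _ c)
  | ex φ ih =>
    have h : ∀ c, M.mixing.val φ (Fin.snoc (fun i => M.toMixing (v i)) (M.toMixing c)) =
        M.val φ (Fin.snoc v c) := fun c => by rw [snoc_toMixing]; exact ih _
    simp only [val]
    apply le_antisymm
    · refine iSup_le fun f => ?_
      rw [← top_inf_eq (M.mixing.val φ _), ← M.iSup_eqVal_toMixing f, iSup_inf_eq]
      refine iSup_mono fun c => ?_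
      rw [← h, M.mixing.eqVal_symm]
      exact M.mixing.inf_val_snoc_le φ _ f (M.toMixing c)
    · exact iSup_le fun c => (h c).ge.trans
        (le_iSup (fun f => M.mixing.val φ (Fin.snoc _ f)) (M.toMixing c))

theorem models_mixing {M : BVModel L B} {Γ : Set (Sentence L)} (h : M.Models Γ) :
    M.mixing.Models Γ := fun φ hφ => by
  rw [← h φ hφ, ← M.val_mixing]
  exact congrArg _ (Subsingleton.elim _ _)

end BVModel

end BooleanLogic

/-! ### The generated fragment is set-sized, so that the forcing algebra lives in the universe `u`
-/

namespace BooleanLogic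

variable {L : Signature.{u}}

namespace Formula

/-- The immediate subformulae of a formula. -/
def immediateSubformulas : {n : ℕ} → Formula L n → Set (Σ n, Formula L n)
  | _, eq _ _ => ∅
  | _, rel _ _ => ∅
  | _, neg φ => {⟨_, φ⟩}
  | _, conj _ φ => Set.range fun i => ⟨_, φ i⟩
  | _, disj _ φ => Set.range fun i => ⟨_, φ i⟩
  | _, all φ => {⟨_, φ⟩}
  | _, ex φ => {⟨_, φ⟩}

/-- The formulae obtained by quantifying the last variable. -/
def quantifications : {n : ℕ} → Formula L n → Set (Σ n, Formula L n)
  | 0, _ => ∅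
  | _ + 1, φ => {⟨_, φ.all⟩, ⟨_, φ.ex⟩}

/-- The formulae obtained from one formula by one closure operation of a fragment. -/
def derived (p : Σ n, Formula L n) : Set (Σ n, Formula L n) :=
  {⟨_, p.2.neg⟩} ∪ {⟨_, p.2.negInside⟩} ∪ p.2.immediateSubformulas ∪ p.2.quantifications ∪
    ⋃ m, Set.range fun σ : Fin p.1 → Term L m => ⟨m, p.2.subst σ⟩

instance small_immediateSubformulas {n : ℕ} (φ : Formula L n) :
    Small.{u} φ.immediateSubformulas := by
  cases φ <;> simp only [immediateSubformulas] <;> infer_instance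

instance small_quantifications {n : ℕ} (φ : Formula L n) : Small.{u} φ.quantifications := by
  cases n <;> simp only [quantifications] <;> infer_instance

instance small_derived (p : Σ n, Formula L n) : Small.{u} (derived p) := by
  unfold derived; infer_instance

end Formula

/-- One step in the generation of a fragment. -/
def fragmentStep (S : Set (Σ n, Formula L n)) : Set (Σ n, Formula L n) :=
  S ∪ (⋃ p ∈ S, Formula.derived p) ∪
    ⋃ n, (Set.image2 (fun φ ψ => ⟨n, φ.and ψ⟩) (Sigma.mk n ⁻¹' S) (Sigma.mk n ⁻¹' S) ∪
      Set.image2 (fun φ ψ => ⟨n, φ.or ψ⟩) (Sigma.mk n ⁻¹' S) (Sigma.mk n ⁻¹' S))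

theorem small_sigma_mk_preimage (S : Set (Σ n, Formula L n)) [Small.{u} S] (n : ℕ) :
    Small.{u} (Sigma.mk n ⁻¹' S : Set (Formula L n)) :=
  small_of_injective (β := S) (f := fun φ => ⟨⟨n, φ.1⟩, φ.2⟩) fun φ ψ h => by
    simpa [Subtype.ext_iff] using h

instance small_fragmentStep (S : Set (Σ n, Formula L n)) [Small.{u} S] :
    Small.{u} (fragmentStep S) := by
  have := small_sigma_mk_preimage S
  unfold fragmentStep; infer_instance

/-- The formulae from which the fragment `L_{T,F}` is generated. -/
def fragmentBase (T : Set (Sentence L)) (F : Set (FormulaSet L)) : Set (Σ n, Formula L n) :=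
  (⋃ n, Set.range fun p : Term L n × Term L n => ⟨n, Formula.eq p.1 p.2⟩) ∪ Sigma.mk 0 '' T ∪
    ⋃ Φ ∈ F, Sigma.mk Φ.n '' Φ.formulas

instance small_fragmentBase (T : Set (Sentence L)) (F : Set (FormulaSet L)) [Small.{u} T]
    [Small.{u} F] : Small.{u} (fragmentBase T F) := by
  have : ∀ Φ : FormulaSet L, Small.{u} Φ.formulas := fun Φ => Φ.small
  unfold fragmentBase; infer_instance

theorem small_fragmentStep_iterate (S : Set (Σ n, Formula L n)) [Small.{u} S] (k : ℕ) :
    Small.{u} (fragmentStep^[k] S) := by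
  induction k with
  | zero => assumption
  | succ k ih => rw [Function.iterate_succ_apply']; infer_instance

/-- Every closure operation takes at most two formulae, so `ω` stages suffice; monotonicity brings
two formulae to a common stage. -/
theorem isFragment_iterate (T : Set (Sentence L)) (F : Set (FormulaSet L)) :
    IsFragment fun n => {φ : Formula L n | (⟨n, φ⟩ : Σ n, Formula L n) ∈
      ⋃ k, fragmentStep^[k] (fragmentBase T F)} := by
  set S : ℕ → Set (Σ n, Formula L n) := fun k => fragmentStep^[k] (fragmentBase T F) with hS
  have step : ∀ k, S (k + 1) = fragmentStep (S k) := fun k => Function.iterate_succ_apply' _ _ _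
  have mono : Monotone S := monotone_nat_of_le_succ fun k => by
    rw [step]; exact fun p hp => Or.inl (Or.inl hp)
  have der : ∀ {p q}, p ∈ ⋃ k, S k → q ∈ Formula.derived p → q ∈ ⋃ k, S k := by
    intro p q hp hq
    obtain ⟨k, hk⟩ := Set.mem_iUnion.1 hp
    refine Set.mem_iUnion.2 ⟨k + 1, ?_⟩
    rw [step]
    exact Or.inl (Or.inr (Set.mem_iUnion₂.2 ⟨p, hk, hq⟩))
  have bin : ∀ {n} {φ ψ : Formula L n}, (⟨n, φ⟩ : Σ n, Formula L n) ∈ ⋃ k, S k →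
      (⟨n, ψ⟩ : Σ n, Formula L n) ∈ ⋃ k, S k →
      (⟨n, φ.and ψ⟩ : Σ n, Formula L n) ∈ ⋃ k, S k ∧
      (⟨n, φ.or ψ⟩ : Σ n, Formula L n) ∈ ⋃ k, S k := by
    intro n φ ψ hφ hψ
    obtain ⟨k, hk⟩ := Set.mem_iUnion.1 hφ
    obtain ⟨l, hl⟩ := Set.mem_iUnion.1 hψ
    have hk' := mono (le_max_left k l) hk
    have hl' := mono (le_max_right k l) hl
    constructor <;> refine Set.mem_iUnion.2 ⟨max k l + 1, ?_⟩ <;> rw [step] <;>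
      refine Or.inr (Set.mem_iUnion.2 ⟨n, ?_⟩)
    · exact Or.inl ⟨φ, hk', ψ, hl', rfl⟩
    · exact Or.inr ⟨φ, hk', ψ, hl', rfl⟩
  have sub : ∀ {n m} {φ : Formula L n} {ψ : Formula L m},
      (⟨n, φ⟩ : Σ n, Formula L n) ∈ ⋃ k, S k → ⟨m, ψ⟩ ∈ φ.immediateSubformulas →
      (⟨m, ψ⟩ : Σ n, Formula L n) ∈ ⋃ k, S k :=
    fun h h' => der h (Or.inl (Or.inl (Or.inr h')))
  have quant : ∀ {n m} {φ : Formula L n} {ψ : Formula L m},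
      (⟨n, φ⟩ : Σ n, Formula L n) ∈ ⋃ k, S k → ⟨m, ψ⟩ ∈ φ.quantifications →
      (⟨m, ψ⟩ : Σ n, Formula L n) ∈ ⋃ k, S k :=
    fun h h' => der h (Or.inl (Or.inr h'))
  exact
    { eq_mem := fun s t => Set.mem_iUnion.2
        ⟨0, Or.inl (Or.inl (Set.mem_iUnion.2 ⟨_, ⟨(s, t), rfl⟩⟩))⟩
      neg_mem := fun h => der h (Or.inl (Or.inl (Or.inl (Or.inl rfl))))
      and_mem := fun h h' => (bin h h').1
      or_mem := fun h h' => (bin h h').2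
      all_mem := fun h => quant h (Or.inl rfl)
      ex_mem := fun h => quant h (Or.inr rfl)
      of_neg := fun h => sub h rfl
      of_conj := fun h i => sub h ⟨i, rfl⟩
      of_disj := fun h i => sub h ⟨i, rfl⟩
      of_all := fun h => sub h rfl
      of_ex := fun h => sub h rfl
      negInside_mem := fun h => der h (Or.inl (Or.inl (Or.inl (Or.inr rfl))))
      subst_mem := fun σ h => der h (Or.inr (Set.mem_iUnion.2 ⟨_, ⟨σ, rfl⟩⟩)) }

instance small_generatedFragment (T : Set (Sentence L)) (F : Set (FormulaSet L)) [Small.{u} T]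
    [Small.{u} F] (n : ℕ) : Small.{u} (generatedFragment T F n) := by
  have := small_fragmentStep_iterate (fragmentBase T F)
  have := small_sigma_mk_preimage (⋃ k, fragmentStep^[k] (fragmentBase T F)) n
  refine small_subset (s := Sigma.mk n ⁻¹' ⋃ k, fragmentStep^[k] (fragmentBase T F))
    fun φ hφ => hφ _ (isFragment_iterate T F) ⟨fun τ hτ => ?_, fun Φ hΦ φ hφ => ?_⟩
  · exact Set.mem_iUnion.2 ⟨0, Or.inl (Or.inr ⟨τ, hτ, rfl⟩)⟩
  · exact Set.mem_iUnion.2 ⟨0, Or.inr (Set.mem_iUnion₂.2 ⟨Φ, hΦ, φ, hφ, rfl⟩)⟩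

end BooleanLogic

/-! ### The complete Boolean algebra of regular elements of a frame -/

section RegularElements

variable {α : Type*} [Order.Frame α]

/-- The regular elements of a frame form a complete Boolean algebra. -/
noncomputable instance Heyting.Regular.completeBooleanAlgebra :
    CompleteBooleanAlgebra (Heyting.Regular α) where
  __ := (inferInstance : BooleanAlgebra (Heyting.Regular α))
  __ := Heyting.Regular.gi.liftCompleteLattice

theorem Heyting.Regular.coe_iInf {ι : Sort*} (f : ι → Heyting.Regular α) :
    ((⨅ i, f i : Heyting.Regular α) : α) = ⨅ i, (f i : α) :=
  Heyting.Regular.gi.gc.u_iInf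

/-- The coercion preserves complements and infima but not suprema, which are therefore expressed by
De Morgan. -/
theorem Heyting.Regular.coe_iSup {ι : Sort*} (f : ι → Heyting.Regular α) :
    ((⨆ i, f i : Heyting.Regular α) : α) = (⨅ i, (f i : α)ᶜ)ᶜ := by
  rw [← compl_compl (⨆ i, f i), compl_iSup]
  simp only [Heyting.Regular.coe_compl, Heyting.Regular.coe_iInf]

theorem Heyting.Regular.iInf_inf_toRegular_le {ι : Sort*} {f : ι → Heyting.Regular α} {a b : α}
    (h : (⨅ i, (f i : α)) ⊓ a ≤ b) :
    (⨅ i, f i) ⊓ Heyting.Regular.toRegular a ≤ Heyting.Regular.toRegular b := by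
  rw [← Heyting.Regular.coe_iInf] at h
  change ((⨅ i, f i : Heyting.Regular α) : α) ⊓ aᶜᶜ ≤ bᶜᶜ
  rw [← (⨅ i, f i : Heyting.Regular α).prop.eq, ← compl_compl_inf_distrib]
  exact compl_le_compl (compl_le_compl h)

/-- The forcing clause for negation: disjointness from the principal down-set of `p`. -/
theorem LowerSet.mem_compl_iff_forall_le {β : Type*} [Preorder β] {S : LowerSet β} {p : β} :
    p ∈ Sᶜ ↔ ∀ q ≤ p, q ∉ S := by
  rw [← LowerSet.Iic_le, le_compl_iff_disjoint_right, disjoint_iff_inf_le]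
  exact ⟨fun h q hq hqS => h (show q ∈ LowerSet.Iic p ⊓ S from ⟨hq, hqS⟩),
    fun h q hq => (h q hq.1 hq.2).elim⟩

end RegularElements

/-! ### Forcing with consistent formulae, and the generic model -/

namespace BooleanLogic

variable {L : Signature.{u}}

/-- The constants of `L` together with countably many new constants. -/
abbrev Name (L : Signature.{u}) : Type u := L.Const ⊕ ULift.{u} ℕ

namespace Name

/-- The interpretation of the names given an interpretation of the new constants. -/
def interp {B : Type u} [CompleteBooleanAlgebra B] (M : BVModel L B) (w : ℕ → M.carrier) :
    Name L → M.carrier :=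
  Sum.elim M.constVal fun k => w k.down

/-- A name as a term, where the `k`-th new constant is the variable `v_k`. -/
def toTerm (N : ℕ) : Name L → Term L (N + 1) :=
  -- Reduction modulo `N + 1` is only a default: under `BoundedBy N` all indices that occur are
  -- below `N`.
  Sum.elim Term.const fun k => Term.var (Fin.ofNat (N + 1) k.down)

/-- The new constants occurring in the tuple are among the first `N`. -/
def BoundedBy (N : ℕ) {n : ℕ} (x : Fin n → Name L) : Prop :=
  ∀ i k, x i = Sum.inr k → k.down < N

theorem exists_boundedBy (m : ℕ) {n : ℕ} (x : Fin n → Name L) :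
    ∃ N, m ≤ N ∧ BoundedBy N x := by
  refine ⟨m + ∑ i, Sum.elim (fun _ => 0) (fun k => k.down + 1) (x i), by simp, fun i k h => ?_⟩
  have h' := Finset.single_le_sum
    (f := fun i => (Sum.elim (fun _ => 0) (fun k => k.down + 1) (x i) : ℕ))
    (fun _ _ => Nat.zero_le _) (Finset.mem_univ i)
  simp only [h, Sum.elim_inr] at h'
  lia

variable {B : Type u} [CompleteBooleanAlgebra B] (M : BVModel L B)

theorem termVal_toTerm {N n : ℕ} {x : Fin n → Name L} (h : BoundedBy N x)
    (u : Fin (N + 1) → M.carrier)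
    (w : ℕ → M.carrier) (hu : ∀ i, u i = w i) (i : Fin n) :
    M.termVal u (toTerm N (x i)) = interp M w (x i) := by
  have h' := h i
  rcases hx : x i with c | k
  · rfl
  · have := h' k hx
    simp only [toTerm, interp, Sum.elim_inr, BVModel.termVal, hu, Fin.ofNat]
    rw [Nat.mod_eq_of_lt (by lia)]

theorem interp_update {N n : ℕ} {x : Fin n → Name L} (h : BoundedBy N x) (w : ℕ → M.carrier)
    (a : M.carrier) :
    interp M (Function.update w N a) ∘ x = interp M w ∘ x := by
  funext i
  have h' := h i
  simp only [Function.comp]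
  rcases hx : x i with c | k
  · rfl
  · have := h' k hx
    simp only [interp, Sum.elim_inr]
    rw [Function.update_of_ne (by lia)]

theorem interp_comp_snoc (w : ℕ → M.carrier) {n : ℕ} (x : Fin n → Name L) (c : Name L) :
    interp M w ∘ Fin.snoc (α := fun _ : Fin (n + 1) => Name L) x c =
      Fin.snoc (α := fun _ : Fin (n + 1) => M.carrier) (interp M w ∘ x) (interp M w c) :=
  Fin.comp_snoc _ _ _

end Name

open Name

/-- In every model of `T`, for every interpretation of the new constants, the value of `ψ` is below
that of `φ`, where `v_i` in `ψ` stands for the `i`-th new constant, and in `φ` for the name `x i`. -/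
def Entails (T : Set (Sentence L)) {m n : ℕ} (ψ : Formula L m) (φ : Formula L n)
    (x : Fin n → Name L) : Prop :=
  ∀ (B : Type u) [CompleteBooleanAlgebra B] (M : BVModel L B), M.Models T →
    ∀ w : ℕ → M.carrier, M.val ψ (fun i => w i) ≤ M.val φ (interp M w ∘ x)

/-- The names of the first `n` new constants. -/
def newNames (L : Signature.{u}) (n : ℕ) (i : Fin n) : Name L := Sum.inr ⟨i⟩

theorem Entails.trans {T : Set (Sentence L)} {k m n : ℕ} {χ : Formula L k} {ψ : Formula L m}
    {φ : Formula L n} {x : Fin n → Name L} (h : Entails T χ ψ (newNames L m))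
    (h' : Entails T ψ φ x) : Entails T χ φ x :=
  fun B _ M hM w => (h B M hM w).trans (h' B M hM w)

/-- The formulae in `A` which are consistent with `T`. -/
abbrev Condition (T : Set (Sentence L)) (A : (n : ℕ) → Set (Formula L n)) : Type (u + 1) :=
  {p : Σ n, A n // Consistent T p.2.1}

variable {T : Set (Sentence L)} {A : (n : ℕ) → Set (Formula L n)} [∀ n, Small.{u} (A n)]

variable (T A) in
/-- A type of the universe of sets equivalent to the type of conditions. -/
def Forcing : Type u := Shrink.{u} (Condition T A)

namespace Forcing

/-- The condition given by a forcing element. -/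
noncomputable def condition (p : Forcing T A) : Condition T A := (equivShrink _).symm p

/-- The formula of a condition. -/
noncomputable def formula (p : Forcing T A) : Formula L p.condition.1.1 := p.condition.1.2.1

theorem formula_mem (p : Forcing T A) : p.formula ∈ A p.condition.1.1 := p.condition.1.2.2

theorem formula_consistent (p : Forcing T A) : Consistent T p.formula := p.condition.2

theorem exists_condition_eq (c : Condition T A) : ∃ p : Forcing T A, p.condition = c :=
  ⟨equivShrink _ c, Equiv.symm_apply_apply _ _⟩

instance : Preorder (Forcing T A) where
  le p q := Entails T p.formula q.formula (newNames L _)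
  le_refl _ _ _ _ _ _ := le_rfl
  le_trans _ _ _ h h' := h.trans h'

end Forcing

variable (T A) in
/-- The set of conditions that entail `φ` at the names `x`. -/
noncomputable def forcingSet {n : ℕ} (φ : Formula L n) (x : Fin n → Name L) :
    LowerSet (Forcing T A) where
  carrier := {p | Entails T p.formula φ x}
  lower' _ _ h h' := Entails.trans h h'

theorem mem_forcingSet {n : ℕ} {φ : Formula L n} {x : Fin n → Name L} {p : Forcing T A} :
    p ∈ forcingSet T A φ x ↔ Entails T p.formula φ x := Iff.rfl

theorem forcingSet_congr {n m : ℕ} {φ : Formula L n} {x : Fin n → Name L} {ψ : Formula L m}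
    {y : Fin m → Name L} (h : ∀ (B : Type u) [CompleteBooleanAlgebra B] (M : BVModel L B)
      (w : ℕ → M.carrier), M.val φ (interp M w ∘ x) = M.val ψ (interp M w ∘ y)) :
    forcingSet T A φ x = forcingSet T A ψ y := by
  ext p
  simp only [SetLike.mem_coe, mem_forcingSet, Entails, h]

theorem exists_extending_assignment {X : Type*} [Nonempty X] {n : ℕ} (v : Fin n → X) :
    ∃ w : ℕ → X, (fun i : Fin n => w i) = v :=
  ⟨fun k => if h : k < n then v ⟨k, h⟩ else Classical.arbitrary X, by funext i; simp⟩

/-- The extension `q` is the conjunction of `p` and `φ(x)`: it is in the fragment by closure under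
substitution and `∧`, and the given model witnesses its consistency. -/
theorem exists_le_mem_forcingSet (hA : IsFragment A) (p : Forcing T A) {n : ℕ} {φ : Formula L n}
    (hφ : φ ∈ A n) (x : Fin n → Name L)
    {B : Type u} [CompleteBooleanAlgebra B] {M : BVModel L B} (hM : M.Models T) {w : ℕ → M.carrier}
    (hw : M.val p.formula (fun i => w i) ⊓ M.val φ (interp M w ∘ x) ≠ ⊥) :
    ∃ q ≤ p, q ∈ forcingSet T A φ x := by
  -- Large enough for both `p` and `φ(x)` to be written in `v_0, …, v_N`.
  obtain ⟨N, hN, hx⟩ := exists_boundedBy p.condition.1.1 x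
  have hN' : p.condition.1.1 ≤ N + 1 := by lia
  let χ : Formula L (N + 1) := (p.formula.castLE hN').and (φ.subst fun i => toTerm N (x i))
  have hχ : χ ∈ A (N + 1) := hA.and_mem (hA.subst_mem _ p.formula_mem) (hA.subst_mem _ hφ)
  have hval : ∀ (B : Type u) [CompleteBooleanAlgebra B] (M : BVModel L B) (w : ℕ → M.carrier),
      M.val χ (fun i => w i) =
        M.val p.formula (fun i => w i) ⊓ M.val φ (interp M w ∘ x) := by
    intro B _ M w
    simp only [χ, BVModel.val_and, BVModel.val_castLE, BVModel.val_subst,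
      termVal_toTerm M hx _ w fun _ => rfl]
    rfl
  obtain ⟨q, hq⟩ := Forcing.exists_condition_eq (T := T) (A := A)
    ⟨⟨N + 1, χ, hχ⟩, B, inferInstance, M, hM, fun i => w i, by rwa [hval]⟩
  have hq' : ∀ (B : Type u) [CompleteBooleanAlgebra B] (M : BVModel L B) (w : ℕ → M.carrier),
      M.val q.formula (fun i => w i) =
        M.val p.formula (fun i => w i) ⊓ M.val φ (interp M w ∘ x) := by
    intro B _ M w
    rw [← hval, Forcing.formula, hq]
  exact ⟨q, fun B _ M _ w => (hq' B M w).trans_le inf_le_left,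
    fun B _ M _ w => (hq' B M w).trans_le inf_le_right⟩

/-- If `p` does not entail `¬φ(x)`, some model gives `p ∧ φ(x)` a non-zero value and `p` extends to
a condition entailing `φ(x)`. No condition entails both, being non-zero somewhere. -/
theorem forcingSet_neg (hA : IsFragment A) {n : ℕ} {φ : Formula L n} (hφ : φ ∈ A n)
    (x : Fin n → Name L) : forcingSet T A φ.neg x = (forcingSet T A φ x)ᶜ := by
  ext p
  simp only [SetLike.mem_coe, LowerSet.mem_compl_iff_forall_le]
  constructor
  · intro hp q hqp hq
    obtain ⟨B, _, M, hM, v, hv⟩ := q.formula_consistent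
    have := M.nonempty
    obtain ⟨w, rfl⟩ := exists_extending_assignment v
    have h : M.val q.formula (fun i => w i) ≤ (M.val φ (interp M w ∘ x))ᶜ :=
      Entails.trans hqp hp B M hM w
    exact hv (le_bot_iff.1 ((le_inf (hq B M hM w) h).trans (inf_compl_self _).le))
  · intro h B _ M hM w
    by_contra hc
    obtain ⟨q, hqp, hq⟩ := exists_le_mem_forcingSet hA p hφ x hM (w := w) fun h' =>
      hc (le_compl_iff_disjoint_right.2 (disjoint_iff.2 h'))
    exact h q hqp hq

theorem isRegular_forcingSet (hA : IsFragment A) {n : ℕ} {φ : Formula L n} (hφ : φ ∈ A n)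
    (x : Fin n → Name L) : Heyting.IsRegular (forcingSet T A φ x) := by
  have h : forcingSet T A φ x = forcingSet T A φ.neg.neg x :=
    forcingSet_congr fun B _ M w => by simp [BVModel.val]
  rw [h, forcingSet_neg hA (hA.neg_mem hφ)]
  exact Heyting.isRegular_compl _

theorem forcingSet_conj {n : ℕ} {ι : Type u} (φ : ι → Formula L n) (x : Fin n → Name L) :
    forcingSet T A (Formula.conj ι φ) x = ⨅ i, forcingSet T A (φ i) x := by
  ext p
  simp only [SetLike.mem_coe, LowerSet.mem_iInf_iff, mem_forcingSet, Entails, BVModel.val,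
    le_iInf_iff]
  exact ⟨fun h i B _ M hM w => h B M hM w i, fun h B _ M hM w i => h i B M hM w⟩

theorem forcingSet_all {n : ℕ} (φ : Formula L (n + 1)) (x : Fin n → Name L) :
    forcingSet T A φ.all x = ⨅ c : Name L, forcingSet T A φ (Fin.snoc x c) := by
  ext p
  simp only [SetLike.mem_coe, LowerSet.mem_iInf_iff, mem_forcingSet]
  constructor
  · intro h c B _ M hM w
    rw [interp_comp_snoc]
    exact (h B M hM w).trans (iInf_le _ _)
  · intro h B _ M hM w
    refine le_iInf fun a => ?_
    obtain ⟨N, hN, hx⟩ := exists_boundedBy p.condition.1.1 x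
    -- The `N`-th new constant occurs neither in `p` nor in `x`, so it can be reinterpreted as an
    -- arbitrary `a`.
    have h' := h (Sum.inr ⟨N⟩) B M hM (Function.update w N a)
    rw [interp_comp_snoc, interp_update M hx] at h'
    have hp : (fun i : Fin p.condition.1.1 => Function.update w N a i) =
        fun i : Fin p.condition.1.1 => w i :=
      funext fun i => Function.update_of_ne (by lia) _ _
    rw [hp] at h'
    refine h'.trans (le_of_eq ?_)
    simp [interp]

theorem forcingSet_disj {n : ℕ} {ι : Type u} (φ : ι → Formula L n) (x : Fin n → Name L) :
    forcingSet T A (Formula.disj ι φ) x =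
      forcingSet T A (Formula.conj ι fun i => (φ i).neg).neg x :=
  forcingSet_congr fun B _ M w => by simp [BVModel.val, compl_iInf]

theorem forcingSet_ex {n : ℕ} (φ : Formula L (n + 1)) (x : Fin n → Name L) :
    forcingSet T A φ.ex x = forcingSet T A φ.neg.all.neg x :=
  forcingSet_congr fun B _ M w => by simp [BVModel.val, compl_iInf]

/-- The Boolean value of an equality of names. -/
noncomputable def eqValue (hA : IsFragment A) (c d : Name L) :
    Heyting.Regular (LowerSet (Forcing T A)) :=
  ⟨forcingSet T A (Formula.eq (Term.var 0) (Term.var 1)) ![c, d],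
    isRegular_forcingSet hA (hA.eq_mem _ _) _⟩

/-- The model of the names, in which the value of a formula of the fragment is the regular set of
the conditions that entail it. -/
noncomputable def genericModel (hA : IsFragment A) :
    BVModel L (Heyting.Regular (LowerSet (Forcing T A))) where
  carrier := Name L
  nonempty := ⟨Sum.inr ⟨0⟩⟩
  eqVal := eqValue hA
  -- Atomic formulae in `R` need not lie in the fragment, so regularity is imposed; for those in the
  -- fragment this changes nothing. Equalities always lie in it.
  relVal R x := Heyting.Regular.toRegular (forcingSet T A (Formula.rel R Term.var) x)
  constVal := Sum.inl
  eqVal_refl c := top_le_iff.1 fun p _ B _ M _ w => by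
    simp [BVModel.val, BVModel.termVal, M.eqVal_refl]
  eqVal_symm c d := Subtype.ext <| forcingSet_congr fun B _ M w => by
    simp [BVModel.val, BVModel.termVal, M.eqVal_symm]
  eqVal_trans c d e := fun p hp B _ M hM w => by
    have h := le_inf (hp.1 B M hM w) (hp.2 B M hM w)
    simp only [BVModel.val, BVModel.termVal, Function.comp] at h ⊢
    exact h.trans (M.eqVal_trans _ _ _)
  relVal_congr R x y := by
    refine Heyting.Regular.iInf_inf_toRegular_le ?_
    rintro p ⟨hp, hp'⟩ B _ M hM w
    have hp := LowerSet.mem_iInf_iff.1 hp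
    exact (le_inf (le_iInf fun i => hp i B M hM w) (hp' B M hM w)).trans
      (M.relVal_congr R (interp M w ∘ x) (interp M w ∘ y))

theorem interp_termVal_genericModel (hA : IsFragment A) {n : ℕ} (t : Term L n)
    (x : Fin n → Name L) {B : Type u} [CompleteBooleanAlgebra B] (M : BVModel L B)
    (w : ℕ → M.carrier) :
    interp M w ((genericModel (T := T) hA).termVal x t) = M.termVal (interp M w ∘ x) t := by
  cases t <;> rfl

/-- The truth lemma: `forcingSet` satisfies the same recursion as the value, with `⋁` and `∃`
treated as `¬⋀¬` and `¬∀¬`. -/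
theorem coe_val_genericModel (hA : IsFragment A) {n : ℕ} {φ : Formula L n} (hφ : φ ∈ A n)
    (x : Fin n → Name L) :
    ((genericModel (T := T) hA).val φ x : LowerSet (Forcing T A)) = forcingSet T A φ x := by
  induction φ with
  | eq s t =>
    refine forcingSet_congr fun B _ M w => ?_
    simp only [BVModel.val, ← interp_termVal_genericModel (T := T) hA]
    rfl
  | rel R ts =>
    refine Eq.trans ?_ (isRegular_forcingSet hA hφ x).eq
    have h : forcingSet T A (Formula.rel R ts) x = forcingSet T A (Formula.rel R Term.var)
        fun i => (genericModel (T := T) hA).termVal x (ts i) :=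
      forcingSet_congr fun B _ M w => by
        simp only [BVModel.val, ← interp_termVal_genericModel (T := T) hA]
        rfl
    rw [h]
    rfl
  | neg φ ih =>
    rw [forcingSet_neg hA (hA.of_neg hφ), ← ih (hA.of_neg hφ)]
    rfl
  | conj ι φ ih =>
    rw [forcingSet_conj]
    exact (Heyting.Regular.coe_iInf _).trans (iInf_congr fun i => ih i (hA.of_conj hφ i) x)
  | disj ι φ ih =>
    -- Fragments are not closed under infinite conjunctions; this one is available as the negation
    -- of the disjunction moved inside.
    have hφ' : (Formula.conj ι fun i => (φ i).neg) ∈ A _ := hA.negInside_mem hφ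
    rw [forcingSet_disj, forcingSet_neg hA hφ', forcingSet_conj]
    refine (Heyting.Regular.coe_iSup _).trans (congrArg _ (iInf_congr fun i => ?_))
    rw [forcingSet_neg hA (hA.of_disj hφ i)]
    exact congrArg _ (ih i (hA.of_disj hφ i) x)
  | all φ ih =>
    rw [forcingSet_all]
    exact (Heyting.Regular.coe_iInf _).trans
      (iInf_congr fun c => ih (hA.of_all hφ) (Fin.snoc x c))
  | ex φ ih =>
    have hφ' : φ.neg.all ∈ A _ := hA.negInside_mem hφ
    rw [forcingSet_ex, forcingSet_neg hA hφ', forcingSet_all]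
    refine (Heyting.Regular.coe_iSup _).trans (congrArg _ (iInf_congr fun c => ?_))
    rw [forcingSet_neg hA (hA.of_ex hφ)]
    exact congrArg _ (ih (hA.of_ex hφ) (Fin.snoc x c))

theorem models_genericModel (hA : IsFragment A) (hT : T ⊆ A 0) :
    (genericModel (T := T) hA).Models T := by
  intro τ hτ
  apply Heyting.Regular.coe_injective
  refine (coe_val_genericModel hA (hT hτ) _).trans (top_le_iff.1 fun p _ B _ M hM w => ?_)
  exact le_top.trans_eq ((hM τ hτ).symm.trans (congrArg _ (Subsingleton.elim _ _)))

theorem nontrivial_regular_forcing (hA : IsFragment A) (hT : BooleanSatisfiable T) :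
    Nontrivial (Heyting.Regular (LowerSet (Forcing T A))) := by
  obtain ⟨B, _, _, M, hM⟩ := hT
  obtain ⟨a⟩ := M.nonempty
  obtain ⟨p, -⟩ := Forcing.exists_condition_eq (T := T) (A := A)
    ⟨⟨1, Formula.eq (Term.var 0) (Term.var 0), hA.eq_mem _ _⟩, B, inferInstance, M, hM,
      fun _ => a, by simp [BVModel.val, M.eqVal_refl]⟩
  refine ⟨⊤, ⊥, fun h => ?_⟩
  have h' : (⊤ : LowerSet (Forcing T A)) = ⊥ := congrArg Heyting.Regular.val h
  exact LowerSet.notMem_bot (h' ▸ LowerSet.mem_top : p ∈ (⊥ : LowerSet (Forcing T A)))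

end BooleanLogic

/-! ### Non-isolation as density, and omission of the types -/

namespace BooleanLogic

variable {L : Signature.{u}}

theorem IsFragment.exists_val_eq_inf_iInf {A : (n : ℕ) → Set (Formula L n)} (hA : IsFragment A)
    {n k : ℕ} {ψ : Formula L n} (hψ : ψ ∈ A n) (f : Fin k → Formula L n) (hf : ∀ i, f i ∈ A n) :
    ∃ θ ∈ A n, ∀ (B : Type u) [CompleteBooleanAlgebra B] (M : BVModel L B) (v : Fin n → M.carrier),
      M.val θ v = M.val ψ v ⊓ ⨅ i, M.val (f i) v := by
  induction k with
  | zero => exact ⟨ψ, hψ, fun B _ M v => by simp⟩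
  | succ k ih =>
    obtain ⟨θ, hθ, h⟩ := ih (fun i => f i.succ) fun i => hf _
    refine ⟨θ.and (f 0), hA.and_mem hθ (hf 0), fun B _ M v => ?_⟩
    rw [BVModel.val_and, h, inf_assoc, inf_comm (⨅ i, _)]
    refine congrArg _ (le_antisymm (le_iInf fun i => ?_) ?_)
    · refine Fin.cases inf_le_left (fun j => inf_le_right.trans (iInf_le _ j)) i
    · exact le_inf (iInf_le _ 0) (le_iInf fun j => iInf_le _ j.succ)

variable {T : Set (Sentence L)} {A : (n : ℕ) → Set (Formula L n)} [∀ n, Small.{u} (A n)]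

open Name

/-- If `Φ` is not isolated then the conditions that entail an element of `Φ` at given names are
dense. -/
theorem exists_mem_forcingSet_of_not_isolated (hA : IsFragment A) {Φ : FormulaSet L}
    (hΦ : ¬ BooleanIsolated T A Φ) (hΦA : Φ.formulas ⊆ A Φ.n) (x : Fin Φ.n → Name L)
    (p : Forcing T A) : ∃ φ ∈ Φ.formulas, ∃ q ≤ p, q ∈ forcingSet T A φ x := by
  obtain ⟨N, hN, hx⟩ := exists_boundedBy p.condition.1.1 x
  have hN' : p.condition.1.1 ≤ N + 1 := by lia
  -- Non-isolation speaks of `φ` at the first `Φ.n` variables, so the new constants are shifted to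
  -- `v_{Φ.n + j}`. `θ` says that `p` holds of the shifted variables and that each `v_i` with `i <
  -- Φ.n` equals the name `x i`.
  obtain ⟨θ, hθA, hθ⟩ := hA.exists_val_eq_inf_iInf
    (ψ := p.formula.subst fun i => Term.var (Fin.natAdd Φ.n (Fin.castLE hN' i)))
    (hA.subst_mem _ p.formula_mem)
    (fun i : Fin Φ.n => Formula.eq (Term.var (Fin.castAdd (N + 1) i))
      ((toTerm N (x i)).subst fun j => Term.var (Fin.natAdd Φ.n j)))
    fun i => hA.eq_mem _ _
  have hval : ∀ (B : Type u) [CompleteBooleanAlgebra B] (M : BVModel L B)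
      (v : Fin (Φ.n + (N + 1)) → M.carrier) (w : ℕ → M.carrier),
      (∀ j, v (Fin.natAdd Φ.n j) = w j) → M.val θ v = M.val p.formula (fun i => w i) ⊓
        ⨅ i, M.eqVal (v (Fin.castAdd (N + 1) i)) (interp M w (x i)) := by
    intro B _ M v w h
    rw [hθ, BVModel.val_subst]
    refine congrArg₂ _ (congrArg _ (funext fun i => h _)) (iInf_congr fun i => ?_)
    rw [BVModel.val, BVModel.termVal_subst]
    exact congrArg _ (termVal_toTerm M hx _ w h i)
  have hcons : Consistent T θ := by
    obtain ⟨B, _, M, hM, v, hv⟩ := p.formula_consistent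
    have := M.nonempty
    obtain ⟨w, rfl⟩ := exists_extending_assignment v
    refine ⟨B, inferInstance, M, hM, Fin.append (interp M w ∘ x) (fun j => w j), ?_⟩
    rw [hval B M _ w (Fin.append_right _ _)]
    simpa [Fin.append_left, M.eqVal_refl] using hv
  obtain ⟨φ, hφ, hφsat⟩ := (not_not.1 hΦ _ θ hθA).1
    ((consistent_iff_booleanSatisfiable T θ).1 hcons)
  obtain ⟨B, _, M, hM, v, hv⟩ := (consistent_iff_booleanSatisfiable T _).2 hφsat
  have := M.nonempty
  rw [BVModel.val_and, BVModel.val_castLE, BVModel.val_castLE] at hv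
  obtain ⟨w, hw⟩ := exists_extending_assignment fun j : Fin (N + 1) =>
    v (Fin.castLE (le_max_left _ _) (Fin.natAdd Φ.n j))
  rw [hval B M _ w fun j => (congrFun hw j).symm] at hv
  refine ⟨φ, hφ, exists_le_mem_forcingSet hA p (hΦA hφ) x hM (w := w) fun h => hv ?_⟩
  rw [← le_bot_iff, ← h, inf_assoc]
  -- The equalities in `θ` carry `φ` from the variables to the names `x`.
  exact inf_le_inf_left _ (M.val_congr φ _ (interp M w ∘ x))

/-- A condition in the complements of all the values of `φ(x)`, `φ ∈ Φ`, would contradict density.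
The supremum is computed directly because `⋁ Φ` need not be in the fragment. -/
theorem val_bigOr_genericModel (hA : IsFragment A) {Φ : FormulaSet L}
    (hΦ : ¬ BooleanIsolated T A Φ) (hΦA : Φ.formulas ⊆ A Φ.n) (x : Fin Φ.n → Name L) :
    (genericModel (T := T) hA).val Φ.bigOr x = ⊤ := by
  have := Φ.small
  apply Heyting.Regular.coe_injective
  refine (Heyting.Regular.coe_iSup _).trans (top_le_iff.1 fun p _ => ?_)
  refine LowerSet.mem_compl_iff_forall_le.2 fun r _ hr => ?_
  obtain ⟨φ, hφ, q, hqr, hq⟩ := exists_mem_forcingSet_of_not_isolated hA hΦ hΦA x r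
  have h := LowerSet.mem_iInf_iff.1 hr (equivShrink Φ.formulas ⟨φ, hφ⟩)
  refine LowerSet.mem_compl_iff_forall_le.1 h q hqr ?_
  exact (coe_val_genericModel hA (hΦA (Subtype.coe_prop _)) x).ge
    (by rwa [Equiv.symm_apply_apply])

theorem val_omittingSentence_genericModel (hA : IsFragment A) (F : Set (FormulaSet L))
    [Small.{u} F] (hF : ∀ Φ ∈ F, ¬ BooleanIsolated T A Φ) (hFA : ∀ Φ ∈ F, Φ.formulas ⊆ A Φ.n) :
    (genericModel (T := T) hA).val (omittingSentence F) Fin.elim0 = ⊤ :=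
  iInf_eq_top.2 fun i => BVModel.val_forall_closure_eq_top _ _ fun x =>
    val_bigOr_genericModel hA (hF _ ((equivShrink F).symm i).2) (hFA _ ((equivShrink F).symm i).2) x

end BooleanLogic

theorem mainTheorem4 (L : Signature.{u}) (T : Set (Sentence L)) [Small.{u} T]
    (hT : BooleanSatisfiable T) (F : Set (FormulaSet L)) [Small.{u} F]
    (hF : ∀ Φ ∈ F, ¬ BooleanIsolated T (generatedFragment T F) Φ) :
    ∃ (B : Type u) (_ : CompleteBooleanAlgebra B) (_ : Nontrivial B) (M : BVModel L B),
      M.Mixing ∧ M.Models (T ∪ {omittingSentence F}) := by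
  have hA := isFragment_generatedFragment T F
  have hc := contains_generatedFragment T F
  refine ⟨_, inferInstance, nontrivial_regular_forcing hA hT, (genericModel hA).mixing,
    BVModel.mixing_mixing _, BVModel.models_mixing ?_⟩
  rintro φ (hφ | rfl)
  · exact models_genericModel hA hc.1 φ hφ
  · exact val_omittingSentence_genericModel hA F hF hc.2
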